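/- Let $X$ be a compact metric space, $A$ a compact convex subset of a Euclidean space $\mathbb R^m$, and $0<\beta<1$. Write $\mathcal P(X)$ for the Borel probability measures on $X$ with the topology of weak convergence, and $W_1$ for the 1-Wasserstein distance on $\mathcal P(X)$, $W_1(\rho,\rho')=\sup_{\|g\|_{\mathrm{Lip}}\le 1}\left|\int g\,d\rho-\int g\,d\rho'\right|$. Let $c:X\times A\times\mathcal P(X)\to\mathbb R$ be a one-stage cost and let $p(\cdot\mid x,a,\mu)\in\mathcal P(X)$ be a transition probability that is, for each $\mu\in\mathcal P(X)$, a stochastic kernel in $(x,a)$. Suppose that (i) whenever $(x_n,a_n,\mu_n)\to(x,a,\mu)$ in $X\times A\times\mathcal P(X)$, then $c(x_n,a_n,\mu_n)\to c(x,a,\mu)$ and $p(\cdot\mid x_n,a_n,\mu_n)\to p(\cdot\mid x,a,\mu)$ weakly; (ii) there are constants $L,K,M$ such that for all $x,\hat x\in X$, $a,\hat a\in A$, $\mu\in\mathcal P(X)$: $|c(x,a,\mu)-c(\hat x,\hat a,\mu)|\le L\,(d_X(x,\hat x)+\|a-\hat a\|)$, $W_1(p(\cdot\mid x,a,\mu),p(\cdot\mid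 \hat x,\hat a,\mu))\le K\,(d_X(x,\hat x)+\|a-\hat a\|)$, and $|c(x,a,\mu)|\le M$. For a stochastic kernel $\pi(da\mid x)$ from $X$ to $A$ and $\mu\in\mathcal P(X)$ let $(\pi\otimes\mu)(da,dx)=\pi(da\mid x)\,\mu(dx)$, a probability measure on $X\times A$. A Markov policy is a sequence $\boldsymbol\pi=(\pi_t)_{t\ge0}$ of stochastic kernels from $X$ to $A$. For a Markov policy $\boldsymbol\pi$, a flow $\boldsymbol\mu=(\mu_t)_{t\ge0}$ in $\mathcal P(X)$ and $\rho\in\mathcal P(X)$ let $$J_\rho(\boldsymbol\pi;\boldsymbol\mu)=E\Big[\sum_{t=0}^\infty\beta^t c(x_t,a_t,\mu_t)\Big],$$ where $x_0\sim\rho$, $a_t\sim\pi_t(\cdot\mid x_t)$ and $x_{t+1}\sim p(\cdot\mid x_t,a_t,\mu_t)$. Given $\mu_{\mathrm{init}}\in\mathcal P(X)$, a pair $(\boldsymbol\pi,\boldsymbol\mu)$ is a non-stationary (infinite-horizon) mean-field equilibrium if $\mu_0=\mu_{\mathrm{init}}$, $\mu_{t+1}(\cdot)=\int p(\cdot\mid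 x,a,\mu_t)\,\pi_t(da\mid x)\,\mu_t(dx)$ for all $t\ge0$, and $J_{\mu_{\mathrm{init}}}(\boldsymbol\pi;\boldsymbol\mu)\le J_{\mu_{\mathrm{init}}}(\boldsymbol\pi';\boldsymbol\mu)$ for every Markov policy $\boldsymbol\pi'$. A pair $(\pi,\mu)$ of a stochastic kernel $\pi$ from $X$ to $A$ and a measure $\mu\in\mathcal P(X)$ is a stationary mean-field equilibrium if $\mu(\cdot)=\int p(\cdot\mid x,a,\mu)\,\pi(da\mid x)\,\mu(dx)$ and the constant policy $(\pi,\pi,\dots)$ minimizes $J_\mu(\,\cdot\,;(\mu,\mu,\dots))$ among all Markov policies. Proposition. Let $(\hat\pi_t,\hat\mu_t)_{t\ge0}$ be a non-stationary mean-field equilibrium, and suppose that $\hat\pi_t\otimes\hat\mu_t$ converges weakly to a probability measure $\nu$ on $X\times A$ as $t\to\infty$. Then $\nu$ is a stationary mean-field equilibrium after disintegration: $\nu=\pi\otimes\mu$ for some stochastic kernel $\pi$ from $X$ to $A$ and some $\mu\in\mathcal P(X)$, and every pair $(\pi,\mu)$ with $\nu=\pi\otimes\mu$ is a stationary mean-field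 equilibrium. -/

import Mathlib

open MeasureTheory ProbabilityTheory Filter Topology
open scoped NNReal ENNReal

namespace MeanField

/-- The data of a discrete-time mean-field game: the one-stage cost `c(x, a, μ)` and the transition
probability `p(· | x, a, μ)`, which for each state-measure `μ` is a stochastic kernel in `(x, a)`. -/
structure MFG (X A : Type*) [MeasurableSpace X] [MeasurableSpace A] where
  cost : X → A → ProbabilityMeasure X → ℝ
  trans : ProbabilityMeasure X → Kernel (X × A) X
  markov : ∀ μ, IsMarkovKernel (trans μ)

attribute [instance] MFG.markov

/-- A (randomized) decision rule `x ↦ π(· | x)`: a stochastic kernel from states to actions. -/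
structure Policy (X A : Type*) [MeasurableSpace X] [MeasurableSpace A] where
  kernel : Kernel X A
  markov : IsMarkovKernel kernel

attribute [instance] Policy.markov

/-- A Markov policy: one decision rule for each time `t = 0, 1, 2, …`. -/
abbrev MarkovPolicy (X A : Type*) [MeasurableSpace X] [MeasurableSpace A] : Type _ :=
  ℕ → Policy X A

section
variable {X A : Type*} [MeasurableSpace X] [MeasurableSpace A]

/-- `p(· | x, a, μ)` as a point of the space of probability measures on `X`. -/
def MFG.nextLaw (G : MFG X A) (x : X) (a : A) (μ : ProbabilityMeasure X) : ProbabilityMeasure X :=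
  ⟨G.trans μ (x, a), inferInstance⟩

/-- The joint law `(π ⊗ μ)(da, dx) = π(da | x) μ(dx)`, on `X × A`. -/
noncomputable def jointLaw (π : Policy X A) (μ : ProbabilityMeasure X) :
    ProbabilityMeasure (X × A) :=
  ⟨(μ : Measure X) ⊗ₘ π.kernel, inferInstance⟩

/-- The law of `(x_{t+1}, a_{t+1})` given `(x_t, a_t)`, when the population is frozen along the flow
`μ`: the next state is drawn from `p(· | x_t, a_t, μ_t)` and the next action from
`π_{t+1}(· | x_{t+1})`. -/
noncomputable def MFG.stepKernel (G : MFG X A) (μ : ℕ → ProbabilityMeasure X)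
    (π : MarkovPolicy X A) (t : ℕ) : Kernel (X × A) (X × A) :=
  G.trans (μ t) ⊗ₖ (Kernel.prodMkLeft (X × A) (π (t + 1)).kernel)

instance (G : MFG X A) (μ : ℕ → ProbabilityMeasure X) (π : MarkovPolicy X A) (t : ℕ) :
    IsMarkovKernel (G.stepKernel μ π t) := by
  unfold MFG.stepKernel; infer_instance

/-- The same step, as a kernel from histories `(x_0, a_0, …, x_t, a_t)`. -/
noncomputable def MFG.historyKernel (G : MFG X A) (μ : ℕ → ProbabilityMeasure X)
    (π : MarkovPolicy X A) (t : ℕ) : Kernel (Finset.Iic t → X × A) (X × A) :=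
  (G.stepKernel μ π t).comap (fun h => h ⟨t, Finset.mem_Iic.2 le_rfl⟩) (measurable_pi_apply _)

instance (G : MFG X A) (μ : ℕ → ProbabilityMeasure X) (π : MarkovPolicy X A) (t : ℕ) :
    IsMarkovKernel (G.historyKernel μ π t) := by
  unfold MFG.historyKernel; infer_instance

/-- The law of the state-action trajectory `(x_t, a_t)_{t ≥ 0}` of a single player who starts from
`x_0 ∼ μinit` and uses the Markov policy `π` against the flow `μ`. -/
noncomputable def MFG.trajectoryLaw (G : MFG X A) (μinit : ProbabilityMeasure X)
    (μ : ℕ → ProbabilityMeasure X) (π : MarkovPolicy X A) : Measure (ℕ → X × A) :=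
  Kernel.trajMeasure (X := fun _ => X × A)
    (jointLaw (π 0) μinit : Measure (X × A)) (G.historyKernel μ π)

/-- The expected discounted cost `E^π[∑_{t ≥ 0} β^t c(x_t, a_t, μ_t)]`. -/
noncomputable def MFG.discountedCost (G : MFG X A) (β : ℝ) (μinit : ProbabilityMeasure X)
    (μ : ℕ → ProbabilityMeasure X) (π : MarkovPolicy X A) : ℝ :=
  ∫ ω, ∑' t : ℕ, β ^ t * G.cost (ω t).1 (ω t).2 (μ t) ∂(G.trajectoryLaw μinit μ π)

/-- The measure `∫ p(· | x, a, μ) π(da | x) μ(dx)` on `X`. -/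
noncomputable def MFG.evolve (G : MFG X A) (π : Policy X A) (μ : ProbabilityMeasure X) :
    Measure X :=
  (jointLaw π μ : Measure (X × A)).bind (G.trans μ)

/-- `(π_t, μ_t)_{t ≥ 0}` is a mean-field equilibrium of the non-stationary infinite-horizon game
with initial state-measure `μinit`. -/
structure IsNonstationaryMFE (G : MFG X A) (β : ℝ) (μinit : ProbabilityMeasure X)
    (π : MarkovPolicy X A) (μ : ℕ → ProbabilityMeasure X) : Prop where
  initial : μ 0 = μinit
  flow : ∀ t, (μ (t + 1) : Measure X) = G.evolve (π t) (μ t)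
  optimal : ∀ π' : MarkovPolicy X A,
    G.discountedCost β μinit μ π ≤ G.discountedCost β μinit μ π'

/-- `(π, μ)` is a stationary mean-field equilibrium: `μ` is invariant, and the time-independent
policy `π` is optimal among all Markov policies against the constant flow `μ`, for `x_0 ∼ μ`. -/
structure IsStationaryMFE (G : MFG X A) (β : ℝ) (π : Policy X A) (μ : ProbabilityMeasure X) :
    Prop where
  invariant : (μ : Measure X) = G.evolve π μ
  optimal : ∀ π' : MarkovPolicy X A,
    G.discountedCost β μ (fun _ => μ) (fun _ => π) ≤ G.discountedCost β μ (fun _ => μ) π'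

/-- The 1-Wasserstein distance, in its dual form. -/
noncomputable def wasserstein1 {Y : Type*} [MeasurableSpace Y] [PseudoMetricSpace Y]
    (μ ν : ProbabilityMeasure Y) : ℝ≥0∞ :=
  ⨆ (g : Y → ℝ) (_ : LipschitzWith 1 g), ENNReal.ofReal |∫ y, g y ∂(μ : Measure Y) - ∫ y, g y ∂(ν : Measure Y)|

/-- Continuous convergence of the cost and weakly continuous convergence of the transition
probability: both are sequentially continuous jointly in `(x, a, μ)`, where spaces of probability
measures carry the topology of weak convergence. -/
structure ContinuousComponents [TopologicalSpace X] [OpensMeasurableSpace X] [TopologicalSpace A]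
    (G : MFG X A) : Prop where
  cost : SeqContinuous fun z : X × A × ProbabilityMeasure X => G.cost z.1 z.2.1 z.2.2
  trans : SeqContinuous fun z : X × A × ProbabilityMeasure X => G.nextLaw z.1 z.2.1 z.2.2

/-- The cost and the transition probability are Lipschitz in `(x, a)`, uniformly in `μ` (the latter
for the 1-Wasserstein distance), and the cost is bounded. -/
structure LipschitzComponents [PseudoMetricSpace X] [PseudoMetricSpace A] (G : MFG X A) : Prop where
  cost : ∃ L : ℝ, ∀ (x x' : X) (a a' : A) (μ : ProbabilityMeasure X),
    |G.cost x a μ - G.cost x' a' μ| ≤ L * (dist x x' + dist a a')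
  trans : ∃ K : ℝ, ∀ (x x' : X) (a a' : A) (μ : ProbabilityMeasure X),
    wasserstein1 (G.nextLaw x a μ) (G.nextLaw x' a' μ) ≤
      ENNReal.ofReal (K * (dist x x' + dist a a'))
  bounded : ∃ M : ℝ, ∀ (x : X) (a : A) (μ : ProbabilityMeasure X), |G.cost x a μ| ≤ M

end

end MeanField

namespace MeanField

/-! ### Weak convergence on compact spaces -/

section WeakConvergence

variable {Z : Type*} [TopologicalSpace Z] [CompactSpace Z] [MeasurableSpace Z]
  [OpensMeasurableSpace Z]

/-! Fix value functions `W t` and call the Bellman gap at `(x, a)` the one-stage cost plus the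
discounted mean of `W (t + 1)` minus `W t x`. By telescoping (`MFG.hasSum_bellmanGap`), the cost of
a policy is the mean of `W 0` plus the discounted sum of its expected gaps. If `W` solves the
Bellman equation, gaps are nonnegative with infimum zero over actions, so a policy is optimal
exactly when its expected gap vanishes at every time. Optimality thus becomes one integral identity
per time against `π_t ⊗ μ_t`, a form that survives weak limits if the gaps vary continuously with
time.

That continuity comes from adjoining `∞` to time. Convergence of the joint laws makes them a
continuous family on `OnePoint ℕ`, and the shift extends continuously by fixing `∞`. One Bellman
equation on `OnePoint ℕ × X` (`ContinuousComponents.exists_value`) then gives a continuous solution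
whose slice at `∞` solves the stationary equation. The flow equation and the zero-gap identity hold
at all finite times, hence at `∞` by density. Both are stated through `ν`, so any disintegration of
it works. -/

lemma integrable_of_continuous {f : Z → ℝ} (hf : Continuous f) (ν : Measure Z)
    [IsFiniteMeasure ν] : Integrable f ν :=
  (BoundedContinuousFunction.mkOfCompact ⟨f, hf⟩).integrable ν

/-- The pairing between continuous functions and probability measures on a compact space is jointly
continuous. -/
lemma continuous_integral_pairing :
    Continuous fun p : C(Z, ℝ) × ProbabilityMeasure Z => ∫ z, p.1 z ∂(p.2 : Measure Z) := by
  -- Weak continuity in the measure for fixed `f`, together with a Lipschitz bound in `f` uniform in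
  -- the measure, gives joint continuity.
  refine continuous_prod_of_continuous_lipschitzWith _ 1 (fun f => ?_) (fun ν => ?_)
  · exact ProbabilityMeasure.continuous_integral_boundedContinuousFunction
      (BoundedContinuousFunction.mkOfCompact f)
  · refine LipschitzWith.of_dist_le_mul fun f g => ?_
    rw [dist_eq_norm, dist_eq_norm, NNReal.coe_one, one_mul,
      ← integral_sub (integrable_of_continuous f.continuous _)
        (integrable_of_continuous g.continuous _)]
    refine (norm_integral_le_of_norm_le_const (C := ‖f - g‖)
      (Eventually.of_forall fun z => (f - g).norm_coe_le_norm z)).trans ?_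
    simp

/-- Currying makes `s ↦ f (s, ·)` continuous for the sup norm, so integrand and measure may vary
together. -/
lemma continuous_integral_of_continuous {S : Type*} [TopologicalSpace S] {f : S × Z → ℝ}
    (hf : Continuous f) {κ : S → ProbabilityMeasure Z} (hκ : Continuous κ) :
    Continuous fun s => ∫ z, f (s, z) ∂(κ s : Measure Z) :=
  continuous_integral_pairing.comp
    ((ContinuousMap.curry ⟨f, hf⟩).continuous.prodMk hκ)

end WeakConvergence

/-! ### The Bellman equation -/

section Bellman

variable {Z A : Type*} [TopologicalSpace Z] [CompactSpace Z] [TopologicalSpace A] [CompactSpace A]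

omit [CompactSpace Z] in
lemma bddBelow_range_section {q : Z × A → ℝ} (hq : Continuous q) (z : Z) :
    BddBelow (Set.range fun a => q (z, a)) :=
  (isCompact_range (hq.comp (Continuous.prodMk_right z))).bddBelow

-- Compactness of `A` supplies the lower semicontinuity of the infimum; upper semicontinuity is
-- general.
omit [CompactSpace Z] in
lemma continuous_iInf_section [Nonempty A] {q : Z × A → ℝ} (hq : Continuous q) :
    Continuous fun z => ⨅ a, q (z, a) := by
  have h := isCompact_univ.continuous_sInf (K := (Set.univ : Set A)) (f := fun z a => q (z, a)) hq
  simpa only [Set.image_univ] using! h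

/-- A Bellman operator whose continuation operator `E` is non-expansive has a fixed point. -/
lemma exists_bellman_fixedPoint [Nonempty A] (c : C(Z × A, ℝ)) (E : C(Z, ℝ) → C(Z × A, ℝ))
    (hE : ∀ V W w, |E V w - E W w| ≤ dist V W) {β : ℝ} (hβ0 : 0 ≤ β) (hβ1 : β < 1) :
    ∃ V : C(Z, ℝ), ∀ z, V z = ⨅ a, (c (z, a) + β * E V (z, a)) := by
  have hq : ∀ V, Continuous fun w => c w + β * E V w := fun V =>
    c.continuous.add (continuous_const.mul (E V).continuous)
  let T : C(Z, ℝ) → C(Z, ℝ) := fun V => ⟨_, continuous_iInf_section (hq V)⟩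
  -- This one-sided bound, used again with `V` and `W` exchanged, gives the contraction with factor
  -- `β`.
  have hle : ∀ V W z, T V z ≤ T W z + β * dist V W := by
    intro V W z
    rw [← sub_le_iff_le_add]
    refine le_ciInf fun a => ?_
    have h1 : T V z ≤ c (z, a) + β * E V (z, a) := ciInf_le (bddBelow_range_section (hq V) z) a
    have h2 := mul_le_mul_of_nonneg_left ((abs_le.1 (hE V W (z, a))).2) hβ0
    linarith
  have hT : ContractingWith ⟨β, hβ0⟩ T := by
    refine ⟨by exact_mod_cast hβ1, LipschitzWith.of_dist_le_mul fun V W => ?_⟩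
    refine (ContinuousMap.dist_le (by positivity)).2 fun z => ?_
    rw [Real.dist_eq, abs_le]
    have h1 := hle V W z
    have h2 := hle W V z
    rw [dist_comm W V] at h2
    change -(β * dist V W) ≤ _ ∧ _ ≤ β * dist V W
    constructor <;> linarith
  refine ⟨hT.fixedPoint T, fun z => ?_⟩
  exact (DFunLike.congr_fun hT.fixedPoint_isFixedPt z).symm

end Bellman

/-- Measurable selection of nearly optimal actions. -/
lemma exists_measurable_selection {X A : Type*} [MeasurableSpace X] [TopologicalSpace X]
    [OpensMeasurableSpace X] [TopologicalSpace A] [MeasurableSpace A]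
    [TopologicalSpace.SeparableSpace A] [Nonempty A] {q : X × A → ℝ} (hq : Continuous q)
    {W : X → ℝ} (hW : Measurable W) (h : ∀ x, ∃ a, q (x, a) < W x) :
    ∃ f : X → A, Measurable f ∧ ∀ x, q (x, f x) < W x := by
  classical
  -- The strict inequality is open in the action, so it holds at some point of a dense sequence; the
  -- selector takes the first such index, which is measurable in `x`.
  have hp : ∀ x, ∃ n, q (x, TopologicalSpace.denseSeq A n) < W x := fun x =>
    (TopologicalSpace.denseRange_denseSeq A).exists_mem_open
      ((isOpen_Iio (a := W x)).preimage (hq.comp (Continuous.prodMk_right x))) (h x)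
  refine ⟨fun x => TopologicalSpace.denseSeq A (Nat.find (hp x)), ?_, fun x => Nat.find_spec (hp x)⟩
  refine (measurable_from_nat (f := TopologicalSpace.denseSeq A)).comp (measurable_find hp fun n => ?_)
  exact measurableSet_lt (hq.comp (Continuous.prodMk_left _)).measurable hW

/-! ### Laws along trajectories and the performance-difference formula -/

section Trajectory

variable {X A : Type*} [MeasurableSpace X] [MeasurableSpace A]

/-- The new action depends on the past only through the new state, so the disintegrated form of the
joint law propagates in time. -/
lemma MFG.stepKernel_comp_jointLaw (G : MFG X A) (μ : ℕ → ProbabilityMeasure X)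
    (π : MarkovPolicy X A) (t : ℕ) {ρ ρ' : ProbabilityMeasure X}
    (h : (ρ' : Measure X) = G.trans (μ t) ∘ₘ (jointLaw (π t) ρ : Measure (X × A))) :
    G.stepKernel μ π t ∘ₘ (jointLaw (π t) ρ : Measure (X × A)) = jointLaw (π (t + 1)) ρ' := by
  ext s hs
  change _ = ((ρ' : Measure X) ⊗ₘ (π (t + 1)).kernel) s
  rw [Measure.bind_apply hs (Kernel.aemeasurable _), Measure.compProd_apply hs, h,
    Measure.lintegral_bind (Kernel.aemeasurable _)
      (Kernel.measurable_kernel_prodMk_left hs).aemeasurable]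
  refine lintegral_congr fun z => ?_
  rw [MFG.stepKernel, Kernel.compProd_apply hs]
  rfl

/-- The law of the state-action pair at time `t` is the joint law of the policy and the law of the
state at time `t`. -/
lemma MFG.map_eval_trajectoryLaw (G : MFG X A) (μ : ℕ → ProbabilityMeasure X)
    (π : MarkovPolicy X A) (ρ : ℕ → ProbabilityMeasure X)
    (hρ : ∀ t, (ρ (t + 1) : Measure X) =
      G.trans (μ t) ∘ₘ (jointLaw (π t) (ρ t) : Measure (X × A))) (t : ℕ) :
    (G.trajectoryLaw (ρ 0) μ π).map (fun ω => ω t) = jointLaw (π t) (ρ t) := by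
  induction t with
  | zero =>
    have h0 : (fun ω : ℕ → X × A => ω 0) =
        MeasurableEquiv.piUnique (fun _ : Finset.Iic 0 => X × A) ∘
          Preorder.frestrictLe (π := fun _ => X × A) 0 := rfl
    rw [h0, ← Measure.map_map (by fun_prop) (by fun_prop), MFG.trajectoryLaw, Kernel.trajMeasure,
      Measure.map_comp _ _ (by fun_prop), Kernel.traj_map_frestrictLe, Kernel.partialTraj_self,
      Measure.id_comp, Measure.map_map (by fun_prop) (by fun_prop)]
    convert! Measure.map_id
  | succ t ih =>
    -- The second marginal of (history, next pair) is the law at time `t + 1`; the history kernel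
    -- reads only the last coordinate, so the induction hypothesis suffices.
    have h1 := congrArg Measure.snd (Kernel.map_frestrictLe_trajMeasure_compProd_eq_map_trajMeasure
      (X := fun _ => X × A) (μ₀ := (jointLaw (π 0) (ρ 0) : Measure (X × A)))
      (κ := G.historyKernel μ π) (a := t))
    rw [Measure.snd_compProd, Measure.snd_map_prodMk (by fun_prop)] at h1
    refine h1.symm.trans ?_
    rw [← G.stepKernel_comp_jointLaw μ π t (hρ t), ← ih]
    ext s hs
    rw [Measure.bind_apply hs (Kernel.aemeasurable _), Measure.bind_apply hs (Kernel.aemeasurable _),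
      lintegral_map (Kernel.measurable_coe _ hs) (by fun_prop),
      lintegral_map (Kernel.measurable_coe _ hs) (by fun_prop)]
    rfl

/-- The law of the state of a player who uses the policy `π` against the flow `μ`. -/
noncomputable def MFG.stateLaw (G : MFG X A) (ρ : ProbabilityMeasure X)
    (μ : ℕ → ProbabilityMeasure X) (π : MarkovPolicy X A) : ℕ → ProbabilityMeasure X
  | 0 => ρ
  | t + 1 => ⟨G.trans (μ t) ∘ₘ (jointLaw (π t) (G.stateLaw ρ μ π t) : Measure (X × A)),
      inferInstance⟩

/-- The excess of the one-stage cost plus the discounted continuation value `W'` over the value `W`,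
for a player at `x` who takes the action `a` against the population `m`. -/
noncomputable def MFG.bellmanGap (G : MFG X A) (β : ℝ) (m : ProbabilityMeasure X) (W W' : X → ℝ)
    (z : X × A) : ℝ :=
  G.cost z.1 z.2 m + β * ∫ y, W' y ∂(G.trans m z) - W z.1

lemma integrable_of_measurable_of_bound {Ω : Type*} [MeasurableSpace Ω] {f : Ω → ℝ}
    (hf : Measurable f) {C : ℝ} (hC : ∀ z, |f z| ≤ C) (P : Measure Ω) [IsFiniteMeasure P] :
    Integrable f P :=
  .of_bound hf.aestronglyMeasurable C (Eventually.of_forall hC)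

lemma integral_measureComp {S T : Type*} [MeasurableSpace S] [MeasurableSpace T] {P : Measure S}
    {κ : Kernel S T} {f : T → ℝ} (hf : Integrable f (κ ∘ₘ P)) :
    ∫ y, f y ∂(κ ∘ₘ P) = ∫ x, ∫ y, f y ∂(κ x) ∂P := by
  rw [Measure.comp_eq_comp_const_apply] at hf ⊢
  rw [Kernel.integral_comp hf, Kernel.const_apply]

/-- Performance-difference formula: the discounted cost of a policy is the value at the initial
state plus the discounted sum of the expected Bellman gaps. -/
lemma MFG.hasSum_bellmanGap (G : MFG X A) {β : ℝ} (hβ0 : 0 ≤ β) (hβ1 : β < 1)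
    (μ : ℕ → ProbabilityMeasure X) (π : MarkovPolicy X A) (ρ : ℕ → ProbabilityMeasure X)
    (hρ : ∀ t, (ρ (t + 1) : Measure X) =
      G.trans (μ t) ∘ₘ (jointLaw (π t) (ρ t) : Measure (X × A)))
    (hc : ∀ t, Measurable fun z : X × A => G.cost z.1 z.2 (μ t)) {M : ℝ}
    (hM : ∀ x a m, |G.cost x a m| ≤ M) (W : ℕ → X → ℝ) (hW : ∀ t, Measurable (W t)) {B : ℝ}
    (hB : ∀ t x, |W t x| ≤ B) :
    HasSum (fun t => β ^ t * ∫ z, G.bellmanGap β (μ t) (W t) (W (t + 1)) z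
        ∂(jointLaw (π t) (ρ t) : Measure (X × A)))
      (G.discountedCost β (ρ 0) μ π - ∫ x, W 0 x ∂(ρ 0 : Measure X)) := by
  have hmap := G.map_eval_trajectoryLaw μ π ρ hρ
  have hprob : IsProbabilityMeasure (G.trajectoryLaw (ρ 0) μ π) := by
    unfold MFG.trajectoryLaw; infer_instance
  have hgeo : Summable fun t : ℕ => β ^ t := summable_geometric_of_lt_one hβ0 hβ1
  have hmeas : ∀ t, Measurable fun ω : ℕ → X × A => G.cost (ω t).1 (ω t).2 (μ t) := fun t =>
    (hc t).comp (measurable_pi_apply t)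
  have hcost : HasSum (fun t => β ^ t * ∫ z, G.cost z.1 z.2 (μ t)
      ∂(jointLaw (π t) (ρ t) : Measure (X × A))) (G.discountedCost β (ρ 0) μ π) := by
    have hbd : ∀ (t : ℕ) (ω : ℕ → X × A), |β ^ t * G.cost (ω t).1 (ω t).2 (μ t)| ≤ β ^ t * M :=
      fun t ω => by
        rw [abs_mul, abs_of_nonneg (pow_nonneg hβ0 t)]
        exact mul_le_mul_of_nonneg_left (hM _ _ _) (pow_nonneg hβ0 t)
    have hint : ∀ t : ℕ, Integrable (fun ω : ℕ → X × A => β ^ t * G.cost (ω t).1 (ω t).2 (μ t))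
        (G.trajectoryLaw (ρ 0) μ π) := fun t =>
      integrable_of_measurable_of_bound ((hmeas t).const_mul _) (hbd t) _
    -- The bound `β ^ t * M` justifies exchanging expectation and sum.
    have h := hasSum_integral_of_summable_integral_norm hint
      (Summable.of_nonneg_of_le (fun t => integral_nonneg fun _ => norm_nonneg _)
        (fun t => (integral_mono (hint t).norm (integrable_const _) (hbd t)).trans_eq (by simp))
        (hgeo.mul_right M))
    refine h.congr_fun fun t => ?_
    rw [← hmap t, integral_map (measurable_pi_apply t).aemeasurable (hc t).aestronglyMeasurable,
      integral_const_mul]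
  have hWint : ∀ t (P : Measure X) [IsFiniteMeasure P], Integrable (W t) P := fun t P _ =>
    integrable_of_measurable_of_bound (hW t) (hB t) P
  set u : ℕ → ℝ := fun t => β ^ t * ∫ x, W t x ∂(ρ t : Measure X) with hu
  have hsum : Summable u := by
    refine .of_norm_bounded (hgeo.mul_right B) fun t => ?_
    rw [norm_mul, Real.norm_of_nonneg (pow_nonneg hβ0 t)]
    refine mul_le_mul_of_nonneg_left ?_ (pow_nonneg hβ0 t)
    exact (norm_integral_le_of_norm_le_const (Eventually.of_forall (hB t))).trans_eq (by simp)
  -- The non-cost part of the `t`-th gap term is `u (t + 1) - u t`: the factor `β` of the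
  -- continuation value raises `β ^ t` to `β ^ (t + 1)`.
  have htel : HasSum (fun t => u (t + 1) - u t) (-∫ x, W 0 x ∂(ρ 0 : Measure X)) := by
    have h := ((hasSum_nat_add_iff' 1).2 hsum.hasSum).sub hsum.hasSum
    rw [Finset.sum_range_one, sub_sub_cancel_left] at h
    simpa [hu] using! h
  rw [sub_eq_add_neg]
  refine (hcost.add htel).congr_fun fun t => ?_
  have hfst : ∫ z, W t z.1 ∂(jointLaw (π t) (ρ t) : Measure (X × A)) =
      ∫ x, W t x ∂(ρ t : Measure X) := by
    rw [← integral_map (φ := Prod.fst) (by fun_prop) (hW t).aestronglyMeasurable]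
    congr 1
    exact Measure.fst_compProd _ _
  have hnext : ∫ z, ∫ y, W (t + 1) y ∂(G.trans (μ t) z)
      ∂(jointLaw (π t) (ρ t) : Measure (X × A)) =
      ∫ x, W (t + 1) x ∂(ρ (t + 1) : Measure X) := by
    have h := hWint (t + 1) (ρ (t + 1))
    rw [hρ t] at h ⊢
    exact (integral_measureComp h).symm
  have hi1 : Integrable (fun z : X × A => G.cost z.1 z.2 (μ t))
      (jointLaw (π t) (ρ t) : Measure (X × A)) :=
    integrable_of_measurable_of_bound (hc t) (fun z => hM _ _ _) _
  have hi2 : Integrable (fun z : X × A => ∫ y, W (t + 1) y ∂(G.trans (μ t) z))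
      (jointLaw (π t) (ρ t) : Measure (X × A)) := by
    have h := hWint (t + 1) (ρ (t + 1))
    rw [hρ t] at h
    exact h.integral_comp
  have hi3 : Integrable (fun z : X × A => W t z.1) (jointLaw (π t) (ρ t) : Measure (X × A)) :=
    integrable_of_measurable_of_bound ((hW t).comp measurable_fst) (fun z => hB t _) _
  simp only [MFG.bellmanGap]
  have hi12 := hi1.add (hi2.const_mul β)
  simp only [Pi.add_def] at hi12
  rw [integral_sub hi12 hi3, integral_add hi1 (hi2.const_mul β), integral_const_mul, hfst, hnext]
  simp only [hu]
  ring

end Trajectory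

/-! ### Optimality and Bellman gaps -/

section Optimality

variable {X A : Type*} [MeasurableSpace X] [MeasurableSpace A]

lemma MFG.stateLaw_succ (G : MFG X A) (ρ : ProbabilityMeasure X) (μ : ℕ → ProbabilityMeasure X)
    (π : MarkovPolicy X A) (t : ℕ) :
    (G.stateLaw ρ μ π (t + 1) : Measure X) =
      G.trans (μ t) ∘ₘ (jointLaw (π t) (G.stateLaw ρ μ π t) : Measure (X × A)) := rfl

/-- A policy whose expected Bellman gaps vanish is optimal. -/
lemma MFG.discountedCost_le_of_integral_bellmanGap_eq_zero (G : MFG X A) {β : ℝ} (hβ0 : 0 ≤ β)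
    (hβ1 : β < 1) (μ : ℕ → ProbabilityMeasure X) (π : MarkovPolicy X A)
    (ρ : ℕ → ProbabilityMeasure X)
    (hρ : ∀ t, (ρ (t + 1) : Measure X) =
      G.trans (μ t) ∘ₘ (jointLaw (π t) (ρ t) : Measure (X × A)))
    (hc : ∀ t, Measurable fun z : X × A => G.cost z.1 z.2 (μ t)) {M : ℝ}
    (hM : ∀ x a m, |G.cost x a m| ≤ M) (W : ℕ → X → ℝ) (hW : ∀ t, Measurable (W t)) {B : ℝ}
    (hB : ∀ t x, |W t x| ≤ B) (hgap : ∀ t z, 0 ≤ G.bellmanGap β (μ t) (W t) (W (t + 1)) z)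
    (h0 : ∀ t, ∫ z, G.bellmanGap β (μ t) (W t) (W (t + 1)) z
      ∂(jointLaw (π t) (ρ t) : Measure (X × A)) = 0) (π' : MarkovPolicy X A) :
    G.discountedCost β (ρ 0) μ π ≤ G.discountedCost β (ρ 0) μ π' := by
  have h1 := G.hasSum_bellmanGap hβ0 hβ1 μ π ρ hρ hc hM W hW hB
  have h2 := G.hasSum_bellmanGap hβ0 hβ1 μ π' _ (G.stateLaw_succ (ρ 0) μ π') hc hM W hW hB
  -- Both policies start from `ρ 0`, so the offset `∫ W 0` cancels and the gaps are compared term by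
  -- term.
  refine sub_le_sub_iff_right _ |>.1 (hasSum_le (fun t => ?_) h1 h2)
  rw [h0 t, mul_zero]
  exact mul_nonneg (pow_nonneg hβ0 t) (integral_nonneg (hgap t))

/-- The expected Bellman gaps of an optimal policy vanish. -/
lemma MFG.integral_bellmanGap_eq_zero_of_optimal [TopologicalSpace X] [OpensMeasurableSpace X]
    [TopologicalSpace A] [TopologicalSpace.SeparableSpace A] [Nonempty A]
    [OpensMeasurableSpace (X × A)] (G : MFG X A) {β : ℝ} (hβ0 : 0 < β) (hβ1 : β < 1) (μ : ℕ → ProbabilityMeasure X)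
    (π : MarkovPolicy X A) (ρ : ℕ → ProbabilityMeasure X)
    (hρ : ∀ t, (ρ (t + 1) : Measure X) =
      G.trans (μ t) ∘ₘ (jointLaw (π t) (ρ t) : Measure (X × A)))
    (hc : ∀ t, Measurable fun z : X × A => G.cost z.1 z.2 (μ t)) {M : ℝ}
    (hM : ∀ x a m, |G.cost x a m| ≤ M) (W : ℕ → X → ℝ) (hW : ∀ t, Measurable (W t)) {B : ℝ}
    (hB : ∀ t x, |W t x| ≤ B) (hgap : ∀ t z, 0 ≤ G.bellmanGap β (μ t) (W t) (W (t + 1)) z)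
    (hgapc : ∀ t, Continuous (G.bellmanGap β (μ t) (W t) (W (t + 1))))
    (hinf : ∀ t x, ∀ ε > 0, ∃ a, G.bellmanGap β (μ t) (W t) (W (t + 1)) (x, a) < ε)
    (hopt : ∀ π' : MarkovPolicy X A,
      G.discountedCost β (ρ 0) μ π ≤ G.discountedCost β (ρ 0) μ π') (t : ℕ) :
    ∫ z, G.bellmanGap β (μ t) (W t) (W (t + 1)) z
      ∂(jointLaw (π t) (ρ t) : Measure (X × A)) = 0 := by
  have h1 := G.hasSum_bellmanGap hβ0.le hβ1 μ π ρ hρ hc hM W hW hB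
  have hnn : ∀ t, 0 ≤ β ^ t * ∫ z, G.bellmanGap β (μ t) (W t) (W (t + 1)) z
      ∂(jointLaw (π t) (ρ t) : Measure (X × A)) := fun t =>
    mul_nonneg (pow_nonneg hβ0.le t) (integral_nonneg (hgap t))
  -- A deterministic policy with every gap below `ε` costs at most `ε / (1 - β)` above the mean of
  -- `W 0`, and `π` costs no more.
  have hle : ∀ ε > 0, G.discountedCost β (ρ 0) μ π - ∫ x, W 0 x ∂(ρ 0 : Measure X)
      ≤ ε * (1 - β)⁻¹ := by
    intro ε hε
    choose f hf hfε using fun t => exists_measurable_selection (hgapc t)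
      (measurable_const (a := ε)) (fun x => hinf t x ε hε)
    let π' : MarkovPolicy X A := fun t => ⟨Kernel.deterministic (f t) (hf t), inferInstance⟩
    have h2 := G.hasSum_bellmanGap hβ0.le hβ1 μ π' _ (G.stateLaw_succ (ρ 0) μ π') hc hM W hW hB
    refine (sub_le_sub_right (hopt π') _).trans
      (hasSum_le (fun t => ?_) h2 ((hasSum_geometric_of_lt_one hβ0.le hβ1).mul_left ε))
    rw [mul_comm ε]
    refine mul_le_mul_of_nonneg_left ?_ (pow_nonneg hβ0.le t)
    have hae : ∀ᵐ z ∂(jointLaw (π' t) (G.stateLaw (ρ 0) μ π' t) : Measure (X × A)),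
        ‖G.bellmanGap β (μ t) (W t) (W (t + 1)) z‖ ≤ ε := by
      change ∀ᵐ z ∂((_ : Measure X) ⊗ₘ Kernel.deterministic (f t) (hf t)), _
      have hs : MeasurableSet {z | ‖G.bellmanGap β (μ t) (W t) (W (t + 1)) z‖ ≤ ε} :=
        (isClosed_le (hgapc t).norm continuous_const).measurableSet
      refine Measure.ae_compProd_of_ae_ae hs (Eventually.of_forall fun x => ?_)
      rw [Kernel.deterministic_apply]
      refine (ae_dirac_iff (measurable_prodMk_left (x := x) hs)).2 ?_
      exact (Real.norm_of_nonneg (hgap t _)).trans_le (hfε t x).le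
    exact (le_abs_self _).trans ((norm_integral_le_of_norm_le_const hae).trans_eq (by simp))
  have hsum : G.discountedCost β (ρ 0) μ π - ∫ x, W 0 x ∂(ρ 0 : Measure X) = 0 := by
    refine le_antisymm (le_of_forall_pos_le_add fun ε hε => ?_) (h1.nonneg hnn)
    have hβ : 0 < 1 - β := sub_pos.2 hβ1
    have := hle (ε * (1 - β)) (mul_pos hε hβ)
    rwa [mul_assoc, mul_inv_cancel₀ hβ.ne', mul_one, ← zero_add ε] at this
  -- Nonnegative terms with zero sum all vanish, and `β ^ t` is nonzero because `β > 0`.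
  rw [hsum, hasSum_zero_iff_of_nonneg hnn] at h1
  exact (mul_eq_zero.1 (congrFun h1 t)).resolve_left (pow_pos hβ0 t).ne'

end Optimality

/-! ### The Bellman equation along a driven flow -/

section Value

variable {X A : Type*} [MetricSpace X] [CompactSpace X] [MeasurableSpace X] [BorelSpace X]
  [MetricSpace A] [CompactSpace A] [MeasurableSpace A] [BorelSpace A] {G : MFG X A}

-- Weak convergence over a compact metric space is metrizable, so sequential continuity is
-- continuity.
omit [CompactSpace A] [BorelSpace A] in
lemma ContinuousComponents.continuous_cost (hG : ContinuousComponents G) :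
    Continuous fun z : X × A × ProbabilityMeasure X => G.cost z.1 z.2.1 z.2.2 :=
  hG.cost.continuous

omit [CompactSpace A] [BorelSpace A] in
lemma ContinuousComponents.continuous_nextLaw (hG : ContinuousComponents G) :
    Continuous fun z : X × A × ProbabilityMeasure X => G.nextLaw z.1 z.2.1 z.2.2 :=
  hG.trans.continuous

omit [CompactSpace A] [BorelSpace A] in
/-- Continuity of the expected continuation value, jointly in the state, the action and a
parameter that drives the population and the continuation value. -/
lemma ContinuousComponents.continuous_integral_trans (hG : ContinuousComponents G) {S : Type*}
    [TopologicalSpace S] {m : S → ProbabilityMeasure X} (hm : Continuous m) {V : S × X → ℝ}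
    (hV : Continuous V) :
    Continuous fun p : S × (X × A) => ∫ y, V (p.1, y) ∂(G.trans (m p.1) p.2) := by
  have h1 : Continuous fun q : (S × (X × A)) × X => V (q.1.1, q.2) := by fun_prop
  have h2 : Continuous fun p : S × (X × A) => G.nextLaw p.2.1 p.2.2 (m p.1) :=
    hG.continuous_nextLaw.comp (f := fun p : S × (X × A) => (p.2.1, p.2.2, m p.1)) (by fun_prop)
  exact continuous_integral_of_continuous h1 h2

omit [BorelSpace A] in
/-- The Bellman equation for a population that moves along a flow driven by a continuous map of a
compact space: its solution is jointly continuous, with continuous and nonnegative gaps whose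
infimum over actions is zero. -/
lemma ContinuousComponents.exists_value [Nonempty A] (hG : ContinuousComponents G) {β : ℝ}
    (hβ0 : 0 ≤ β) (hβ1 : β < 1) {S : Type*} [TopologicalSpace S] [CompactSpace S] {σ : S → S}
    (hσ : Continuous σ) {m : S → ProbabilityMeasure X} (hm : Continuous m) :
    ∃ V : C(S × X, ℝ),
      (Continuous fun p : S × (X × A) =>
        G.bellmanGap β (m p.1) (fun x => V (p.1, x)) (fun x => V (σ p.1, x)) p.2) ∧
      (∀ s z, 0 ≤ G.bellmanGap β (m s) (fun x => V (s, x)) (fun x => V (σ s, x)) z) ∧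
      ∀ s x, ∀ ε > 0, ∃ a,
        G.bellmanGap β (m s) (fun x => V (s, x)) (fun x => V (σ s, x)) (x, a) < ε := by
  have hcost : Continuous fun p : S × (X × A) => G.cost p.2.1 p.2.2 (m p.1) :=
    hG.continuous_cost.comp (f := fun p : S × (X × A) => (p.2.1, p.2.2, m p.1)) (by fun_prop)
  have hnext : ∀ V : C(S × X, ℝ), Continuous fun p : S × (X × A) =>
      ∫ y, V (σ p.1, y) ∂(G.trans (m p.1) p.2) := fun V =>
    hG.continuous_integral_trans hm (V := fun q => V (σ q.1, q.2)) (by fun_prop)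
  have hassoc : Continuous fun w : (S × X) × A => (w.1.1, (w.1.2, w.2)) := by fun_prop
  -- The parameter `s` is treated as part of the state and moves by `σ`, so the fixed point is
  -- jointly continuous from the start. Averaging against a probability measure is non-expansive.
  obtain ⟨V, hV⟩ := exists_bellman_fixedPoint ⟨_, hcost.comp hassoc⟩
    (fun V => ⟨_, (hnext V).comp hassoc⟩) (fun V W w => by
      change |∫ y, V _ ∂_ - ∫ y, W _ ∂_| ≤ _
      have hi : ∀ U : C(S × X, ℝ), Integrable (fun y => U (σ w.1.1, y))
          (G.trans (m w.1.1) (w.1.2, w.2)) := fun U => integrable_of_continuous (by fun_prop) _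
      rw [← integral_sub (hi V) (hi W)]
      have hd : ∀ y, ‖V (σ w.1.1, y) - W (σ w.1.1, y)‖ ≤ dist V W := fun y =>
        (dist_eq_norm _ _).symm.trans_le (ContinuousMap.dist_apply_le_dist _)
      refine (norm_integral_le_of_norm_le_const (Eventually.of_forall hd)).trans_eq ?_
      simp) hβ0 hβ1
  have hV' : ∀ s x, V (s, x) =
      ⨅ a, (G.cost x a (m s) + β * ∫ y, V (σ s, y) ∂(G.trans (m s) (x, a))) :=
    fun s x => hV (s, x)
  refine ⟨V, ?_, fun s z => ?_, fun s x ε hε => ?_⟩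
  · unfold MFG.bellmanGap
    exact (hcost.add (continuous_const.mul (hnext V))).sub (by fun_prop)
  · rw [MFG.bellmanGap, sub_nonneg, hV' s z.1]
    exact ciInf_le (bddBelow_range_section ((hcost.add (continuous_const.mul (hnext V))).comp
      hassoc) (s, z.1)) z.2
  · obtain ⟨a, ha⟩ := exists_lt_of_ciInf_lt ((hV' s x).symm.trans_lt (lt_add_of_pos_right _ hε))
    exact ⟨a, by rw [MFG.bellmanGap]; linarith⟩

end Value

/-! ### Marginals and disintegration -/

lemma jointLaw_map_fst {X A : Type*} [MeasurableSpace X] [MeasurableSpace A] (π : Policy X A)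
    (μ : ProbabilityMeasure X) :
    (jointLaw π μ).map measurable_fst.aemeasurable = μ :=
  ProbabilityMeasure.toMeasure_injective (Measure.fst_compProd _ _)

/-- Disintegration of a probability measure on `X × A`. -/
lemma exists_jointLaw_eq {X A : Type*} [MeasurableSpace X] [MeasurableSpace A]
    [StandardBorelSpace A] [Nonempty A] (ν : ProbabilityMeasure (X × A)) :
    ∃ (π : Policy X A) (μ : ProbabilityMeasure X), jointLaw π μ = ν :=
  ⟨⟨(ν : Measure (X × A)).condKernel, inferInstance⟩, ν.map measurable_fst.aemeasurable,
    ProbabilityMeasure.toMeasure_injective ((ν : Measure (X × A)).disintegrate _)⟩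

/-! ### Passage to the limit on the one-point compactification of time -/

section Limit

variable {X A : Type*} [MetricSpace X] [CompactSpace X] [MeasurableSpace X] [BorelSpace X]
  [MetricSpace A] [CompactSpace A] [MeasurableSpace A] [BorelSpace A] {G : MFG X A}

/-- The limit of the state-action laws of a non-stationary equilibrium is a stationary
equilibrium. -/
lemma isStationaryMFE_of_tendsto [Nonempty A] {β : ℝ} (hβ0 : 0 < β) (hβ1 : β < 1)
    (hG : ContinuousComponents G) {M : ℝ} (hM : ∀ x a m, |G.cost x a m| ≤ M)
    {μinit : ProbabilityMeasure X} {π : MarkovPolicy X A} {μ : ℕ → ProbabilityMeasure X}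
    (hMFE : IsNonstationaryMFE G β μinit π μ) {π' : Policy X A} {μ' : ProbabilityMeasure X}
    (hlim : Tendsto (fun t => jointLaw (π t) (μ t)) atTop (𝓝 (jointLaw π' μ'))) :
    IsStationaryMFE G β π' μ' := by
  let κ : C(OnePoint ℕ, ProbabilityMeasure (X × A)) := OnePoint.continuousMapMkNat _ _ hlim
  have hκ : ∀ t : ℕ, κ t = jointLaw (π t) (μ t) := fun t => rfl
  have hκ' : κ OnePoint.infty = jointLaw π' μ' := rfl
  -- Taking the population as the first marginal of `κ` makes it continuous at `∞`, with no separate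
  -- convergence assumption.
  let m : OnePoint ℕ → ProbabilityMeasure X := fun s => (κ s).map measurable_fst.aemeasurable
  have hm : Continuous m := (ProbabilityMeasure.continuous_map continuous_fst).comp κ.continuous
  have hmt : ∀ t : ℕ, m t = μ t := fun t => jointLaw_map_fst _ _
  have hm' : m OnePoint.infty = μ' := jointLaw_map_fst _ _
  -- Since the shift fixes `∞`, the flow and Bellman equations become the stationary ones there.
  let σ : C(OnePoint ℕ, OnePoint ℕ) :=
    OnePoint.continuousMapMkNat (fun t => ((t + 1 : ℕ) : OnePoint ℕ)) OnePoint.infty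
      (((OnePoint.continuous_iff_from_nat id).1 continuous_id).comp (tendsto_add_atTop_nat 1))
  have hσt : ∀ t : ℕ, σ t = ((t + 1 : ℕ) : OnePoint ℕ) := fun t => rfl
  have hσ' : σ OnePoint.infty = OnePoint.infty := rfl
  have hinv : (μ' : Measure X) = G.evolve π' μ' := by
    have : IsProbabilityMeasure (G.evolve π' μ') := by unfold MFG.evolve; infer_instance
    refine ext_of_forall_integral_eq_of_IsFiniteMeasure fun f => ?_
    have h1 : Continuous fun s => ∫ x, f x ∂(m (σ s) : Measure X) :=
      (ProbabilityMeasure.continuous_integral_boundedContinuousFunction f).comp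
        (hm.comp σ.continuous)
    have h2 : Continuous fun s => ∫ z, ∫ y, f y ∂(G.trans (m s) z) ∂(κ s : Measure (X × A)) :=
      continuous_integral_of_continuous
        (hG.continuous_integral_trans hm (V := fun q => f q.2) (by fun_prop)) κ.continuous
    -- Both sides are continuous in time and agree on the dense set `ℕ`, by the flow equation, hence
    -- also at `∞`.
    have h3 := congrFun (OnePoint.denseRange_coe.equalizer h1 h2 (funext fun t => by
      simp only [Function.comp_apply]
      have hi := f.integrable (μ (t + 1) : Measure X)
      rw [hσt, hmt, hmt, hκ]
      rw [hMFE.flow t] at hi ⊢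
      exact integral_measureComp hi)) OnePoint.infty
    simp only [hσ', hm', hκ'] at h3
    rw [h3]
    exact (integral_measureComp (f.integrable (G.evolve π' μ'))).symm
  obtain ⟨V, hVc, hV0, hVinf⟩ := hG.exists_value hβ0.le hβ1 σ.continuous hm
  have hcost : ∀ n, Measurable fun z : X × A => G.cost z.1 z.2 n := fun n =>
    (hG.continuous_cost.comp (f := fun z : X × A => (z.1, z.2, n)) (by fun_prop)).measurable
  have hW : ∀ s, Measurable fun x => V (s, x) := fun s =>
    (V.continuous.comp (Continuous.prodMk_right s)).measurable
  have hB : ∀ s x, |V (s, x)| ≤ ‖V‖ := fun s x => V.norm_coe_le_norm (s, x)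
  have hgapt : ∀ t : ℕ, ∫ z, G.bellmanGap β (m t) (fun x => V (t, x)) (fun x => V (σ t, x)) z
      ∂(κ t : Measure (X × A)) = 0 := by
    intro t
    simp only [hmt, hκ, hσt]
    refine G.integral_bellmanGap_eq_zero_of_optimal hβ0 hβ1 μ π μ hMFE.flow (fun t => hcost _) hM
      (fun t x => V ((t : OnePoint ℕ), x)) (fun t => hW t) (fun t => hB t) (fun t z => ?_)
      (fun t => ?_) (fun t x ε hε => ?_) ?_ t
    · simpa only [hmt, hσt] using hV0 t z
    · have h := hVc.comp (Continuous.prodMk_right (t : OnePoint ℕ))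
      simp only [Function.comp_def, hmt, hσt] at h
      exact h
    · simpa only [hmt, hσt] using hVinf t x ε hε
    · simpa only [hMFE.initial] using hMFE.optimal
  have hgap' : ∫ z, G.bellmanGap β μ' (fun x => V (OnePoint.infty, x))
      (fun x => V (OnePoint.infty, x)) z ∂(jointLaw π' μ' : Measure (X × A)) = 0 := by
    -- The expected gap is continuous in time and zero on `ℕ`, hence zero at `∞`.
    have h := congrFun (OnePoint.denseRange_coe.equalizer
      (continuous_integral_of_continuous hVc κ.continuous) continuous_const
      (funext fun t => hgapt t)) OnePoint.infty
    simpa only [hσ', hm', hκ'] using h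
  refine ⟨hinv, fun π'' => ?_⟩
  refine G.discountedCost_le_of_integral_bellmanGap_eq_zero hβ0.le hβ1 (fun _ => μ') (fun _ => π')
    (fun _ => μ') (fun _ => hinv) (fun _ => hcost _) hM (fun _ x => V (OnePoint.infty, x))
    (fun _ => hW _) (fun _ => hB _) (fun _ z => ?_) (fun _ => hgap') π''
  simpa only [hσ', hm'] using hV0 OnePoint.infty z

end Limit

end MeanField

open MeanField in
theorem mainTheorem3
    {X : Type*} [MetricSpace X] [CompactSpace X] [MeasurableSpace X] [BorelSpace X]
    {m : ℕ} (A : Set (EuclideanSpace ℝ (Fin m))) (hAcompact : IsCompact A) (hAconvex : Convex ℝ A)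
    (G : MFG X A) (β : ℝ) (hβ0 : 0 < β) (hβ1 : β < 1)
    (hcont : ContinuousComponents G) (hlip : LipschitzComponents G)
    (μinit : ProbabilityMeasure X) (π : MarkovPolicy X A) (μ : ℕ → ProbabilityMeasure X)
    (hMFE : IsNonstationaryMFE G β μinit π μ)
    (ν : ProbabilityMeasure (X × A))
    (hlim : Tendsto (fun t => jointLaw (π t) (μ t)) atTop (𝓝 ν)) :
    (∃ (πlim : Policy X A) (μlim : ProbabilityMeasure X), jointLaw πlim μlim = ν) ∧
      ∀ (πlim : Policy X A) (μlim : ProbabilityMeasure X),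
        jointLaw πlim μlim = ν → IsStationaryMFE G β πlim μlim := by
  have : CompactSpace A := isCompact_iff_compactSpace.1 hAcompact
  -- A probability measure lives on a nonempty space, so `X × A`, and with it `A`, is nonempty.
  have : Nonempty A := ν.nonempty.map Prod.snd
  have : StandardBorelSpace A := hAcompact.measurableSet.standardBorel
  obtain ⟨M, hM⟩ := hlip.bounded
  refine ⟨exists_jointLaw_eq ν, ?_⟩
  rintro πlim μlim rfl
  exact isStationaryMFE_of_tendsto hβ0 hβ1 hcont hM hMFE hlim
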